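/- Let $X_1,X_2,\dots$ be i.i.d. real random variables with distribution function $F$ and $\mathsf{E}|X_1|<\infty$; let $Z_n=\max(X_1,\dots,X_n)$, let $x^*=\sup\{v\in\mathbb{R}:F(v)<1\}\in(-\infty,\infty]$, and let $U(t)=\inf\{x\in\mathbb{R}: 1/(1-F(x))\ge t\}$ (with $1/0=\infty$) be the tail quantile function. For $\xi\in\mathbb{R}$ let $G_\xi(z)=\exp\{-(1+\xi z)_+^{-1/\xi}\}$, with $G_0(z)=\exp\{-e^{-z}\}$, be the standard generalized extreme value distribution. Suppose that $\xi<1$ and that $F$ is in the maximum domain of attraction of $G_\xi$, that is, there are constants $a_n>0$ and $b_n\in\mathbb{R}$ with $\lim_{n\to\infty}F(a_nz+b_n)^n=G_\xi(z)$ for every $z\in\mathbb{R}$. Then the mean $\overline m_\xi=\int_{-\infty}^{\infty}z\,G_\xi'(z)\,dz$ is finite, and $\overline m_\xi=-\Gamma(-\xi)-1/\xi$ if $\xi\ne0$, while $\overline m_0=\gamma$ is Euler's constant. There exist positive functions $a$ such that, for every $x>0$, $$\lim_{t\to\infty}\frac{U(tx)-U(t)}{a(t)}=\frac{x^{\xi}-1}{\xi}\qquad(\text{read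 as }\log x\text{ if }\xi=0),$$ and for every such $a$ and every real $x<x^*$, the expectation $\mathsf{E}[(Z_n-x)_+]$ is finite and $$\mathsf{E}[(Z_n-x)_+]=(\overline m_\xi+o(1))\,a(n)+U(n)-x\qquad\text{as }n\to\infty .$$ -/

import Mathlib

open Filter Topology MeasureTheory ProbabilityTheory

namespace EVT

/-- The standard generalized extreme value distribution function
`G_ξ(z) = exp (-(1 + ξ z)_+ ^ (-1/ξ))`, with `G_0(z) = exp (-exp (-z))`.
Where `1 + ξ z ≤ 0`, the value is `exp (-∞) = 0` if `ξ > 0` and `exp 0 = 1` if `ξ < 0`. -/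
noncomputable def gevCDF (ξ z : ℝ) : ℝ :=
  if ξ = 0 then Real.exp (-Real.exp (-z))
  else if 0 < 1 + ξ * z then Real.exp (-(1 + ξ * z) ^ (-1 / ξ))
  else if 0 < ξ then 0 else 1

/-- The mean `∫ z G_ξ'(z) dz` of the standard generalized extreme value distribution. -/
noncomputable def gevMean (ξ : ℝ) : ℝ :=
  ∫ z : ℝ, z * deriv (gevCDF ξ) z

/-- `F` belongs to the maximum domain of attraction of `G`: there are norming constants `a_n > 0`
and `b_n` with `F(a_n z + b_n)^n → G(z)` at every continuity point `z` of `G`. -/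
def InMaxDomain (F G : ℝ → ℝ) : Prop :=
  ∃ a b : ℕ → ℝ, (∀ n, 0 < a n) ∧
    ∀ z : ℝ, ContinuousAt G z →
      Tendsto (fun n : ℕ => F (a n * z + b n) ^ n) atTop (𝓝 (G z))

/-- The tail quantile function `U(t) = inf {x | 1 / (1 - F x) ≥ t}`. The reciprocal is taken
in `[0, ∞]`, so that `1 / (1 - F x) = ∞` where `F x = 1`. -/
noncomputable def tailQuantile (F : ℝ → ℝ) (t : ℝ) : ℝ :=
  sInf {x : ℝ | ENNReal.ofReal t ≤ (ENNReal.ofReal (1 - F x))⁻¹}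

/-- The right endpoint `x* = sup {v | F v < 1}`, in the extended reals. -/
noncomputable def rightEndpoint (F : ℝ → ℝ) : EReal :=
  sSup ((fun v : ℝ => (v : EReal)) '' {v : ℝ | F v < 1})

/-- The function `(x ^ ξ - 1) / ξ`, read as `log x` for `ξ = 0`. -/
noncomputable def boxCox (ξ x : ℝ) : ℝ :=
  if ξ = 0 then Real.log x else (x ^ ξ - 1) / ξ

/-- `a` is an auxiliary function of `F` with index `ξ`: it is positive (on the domain `[1, ∞)`
of `U`), and `(U(t x) - U(t)) / a(t) → (x ^ ξ - 1) / ξ` as `t → ∞`, for every `x > 0`. -/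
def IsAuxiliary (F : ℝ → ℝ) (ξ : ℝ) (a : ℝ → ℝ) : Prop :=
  (∀ t : ℝ, 1 ≤ t → 0 < a t) ∧
    ∀ x : ℝ, 0 < x →
      Tendsto (fun t : ℝ => (tailQuantile F (t * x) - tailQuantile F t) / a t) atTop
        (𝓝 (boxCox ξ x))

/-- The maximum `Z_n` of the first `n` terms of a sequence of real functions (`n ≥ 1`). -/
noncomputable def runningMax {Ω : Type*} (X : ℕ → Ω → ℝ) (n : ℕ) (ω : Ω) : ℝ :=
  ⨆ i : Fin n, X i ω

end EVT

namespace EVT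

/-! With U the tail quantile function, U(t) ≤ y iff 1 - 1/t ≤ F(y) for t > 1. Hence Z_n has the law
of U(n/S_n), where S_n has density (1 - s/n)^(n-1) on (0, n) (`map_runningMax`), and E(Z_n - x)_+ -
(U(n) - x) is the integral of (1 - s/n)^(n-1) (max(U(n/s), x) - U(n)) over (0, n).

After division by a(n) the integrand tends to e^(-s) `boxCox ξ s⁻¹`. The integral of this limit is
the mean of G_ξ, because G_ξ(`boxCox ξ s⁻¹`) = e^(-s). Domination comes from a Potter bound, a
constant times s^(-ρ) + s^M with ρ < 1 (`IsAuxiliary.exists_abs_sub_le`). Its source is that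
consecutive dyadic increments of U have ratio tending to 2^ξ. Truncation at x handles s near n,
where n/s is too small for asymptotics.

Auxiliary functions exist because inverting F(a_n z + b_n)^n → G_ξ(z) gives convergence of (U(nx) -
b_n)/a_n. Monotonicity of U extends this to real t, and differencing removes b_n. -/

lemma ofReal_le_inv_ofReal_iff {t p : ℝ} (ht : 0 < t) :
    ENNReal.ofReal t ≤ (ENNReal.ofReal (1 - p))⁻¹ ↔ 1 - t⁻¹ ≤ p := by
  rw [ENNReal.le_inv_iff_le_inv, ← ENNReal.ofReal_inv_of_pos ht,
    ENNReal.ofReal_le_ofReal_iff (inv_nonneg.2 ht.le)]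
  constructor <;> intro h <;> linarith

/-! ### The tail quantile function as a generalised inverse -/

section Quantile

variable (μ : Measure ℝ)

lemma tailQuantile_cdf_eq {t : ℝ} (ht : 0 < t) :
    tailQuantile (cdf μ) t = sInf {x : ℝ | 1 - t⁻¹ ≤ cdf μ x} := by
  unfold tailQuantile
  congr 1
  ext x
  exact ofReal_le_inv_ofReal_iff ht

/-- The level 1 - 1/t lies strictly between 0 and 1, so the level set is nonempty and bounded below;
right continuity of the distribution function makes the infimum attained. For t ≤ 1 boundedness can
fail, hence the condition t > 1 throughout. -/
lemma tailQuantile_le_iff {t : ℝ} (ht : 1 < t) (y : ℝ) :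
    tailQuantile (cdf μ) t ≤ y ↔ 1 - t⁻¹ ≤ cdf μ y := by
  have ht0 : 0 < t := by linarith
  have hinv : 0 < t⁻¹ := inv_pos.2 ht0
  have hinv1 : t⁻¹ < 1 := inv_lt_one_of_one_lt₀ ht
  rw [tailQuantile_cdf_eq μ ht0]
  have hbdd : BddBelow {x : ℝ | 1 - t⁻¹ ≤ cdf μ x} := by
    obtain ⟨x₀, hx₀⟩ :=
      ((tendsto_cdf_atBot μ).eventually (gt_mem_nhds (show (0 : ℝ) < 1 - t⁻¹ by linarith))).exists
    refine ⟨x₀, fun x hx => ?_⟩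
    by_contra! hlt
    exact absurd (hx.trans (monotone_cdf μ hlt.le)) (not_le.2 hx₀)
  have hne : {x : ℝ | 1 - t⁻¹ ≤ cdf μ x}.Nonempty := by
    obtain ⟨x₀, hx₀⟩ :=
      ((tendsto_cdf_atTop μ).eventually (lt_mem_nhds (show 1 - t⁻¹ < (1 : ℝ) by linarith))).exists
    exact ⟨x₀, hx₀.le⟩
  constructor
  · intro h
    have hr : Tendsto (cdf μ) (𝓝[>] y) (𝓝 (cdf μ y)) :=
      ((cdf μ).right_continuous y).mono Set.Ioi_subset_Ici_self
    refine ge_of_tendsto hr ?_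
    filter_upwards [self_mem_nhdsWithin] with z hz
    obtain ⟨x, hx, hxz⟩ := exists_lt_of_csInf_lt hne (h.trans_lt hz)
    exact le_trans hx (monotone_cdf μ hxz.le)
  · intro h
    exact csInf_le hbdd h

lemma lt_tailQuantile_iff {t : ℝ} (ht : 1 < t) (y : ℝ) :
    y < tailQuantile (cdf μ) t ↔ cdf μ y < 1 - t⁻¹ := by
  rw [← not_le, tailQuantile_le_iff μ ht, not_le]

lemma tailQuantile_mono {s t : ℝ} (hs : 1 < s) (hst : s ≤ t) :
    tailQuantile (cdf μ) s ≤ tailQuantile (cdf μ) t := by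
  rw [tailQuantile_le_iff μ hs]
  have h := (tailQuantile_le_iff μ (hs.trans_le hst) _).1 le_rfl
  have : t⁻¹ ≤ s⁻¹ := inv_anti₀ (by linarith) hst
  linarith

lemma eventually_lt_tailQuantile {x : ℝ} (hx : (x : EReal) < rightEndpoint (cdf μ)) :
    ∀ᶠ t in atTop, x < tailQuantile (cdf μ) t := by
  obtain ⟨_, ⟨v, hv, rfl⟩, hxv⟩ := lt_sSup_iff.1 hx
  have hxv' : x < v := EReal.coe_lt_coe_iff.1 hxv
  have h : Tendsto (fun t : ℝ => 1 - t⁻¹) atTop (𝓝 (1 - 0)) :=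
    tendsto_const_nhds.sub tendsto_inv_atTop_zero
  have hv' : cdf μ v < 1 - 0 := by simpa using hv
  filter_upwards [h.eventually (lt_mem_nhds hv'), eventually_gt_atTop 1] with t ht ht1
  exact hxv'.trans ((lt_tailQuantile_iff μ ht1 v).2 ht)

end Quantile

/-! ### The Box-Cox function as the quantile function of G_ξ -/

lemma boxCox_one (ξ : ℝ) : boxCox ξ 1 = 0 := by
  unfold boxCox; split_ifs <;> simp

lemma one_add_mul_boxCox {ξ x : ℝ} (hξ : ξ ≠ 0) : 1 + ξ * boxCox ξ x = x ^ ξ := by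
  simp only [boxCox, hξ, if_false]; field_simp; ring

lemma one_add_mul_boxCox_pos (ξ : ℝ) {x : ℝ} (hx : 0 < x) : 0 < 1 + ξ * boxCox ξ x := by
  by_cases hξ : ξ = 0
  · simp [hξ]
  · rw [one_add_mul_boxCox hξ]; positivity

/-- This change of variable carries every G_ξ to the unit Fréchet law, so most later arguments treat
all ξ alike. -/
lemma gevCDF_boxCox (ξ : ℝ) {x : ℝ} (hx : 0 < x) :
    gevCDF ξ (boxCox ξ x) = Real.exp (-x⁻¹) := by
  have hpos := one_add_mul_boxCox_pos ξ hx
  by_cases hξ : ξ = 0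
  · subst hξ
    simp [gevCDF, boxCox, Real.exp_neg, Real.exp_log hx]
  · rw [gevCDF, if_neg hξ, if_pos hpos, one_add_mul_boxCox hξ, ← Real.rpow_mul hx.le,
      mul_div_cancel₀ _ hξ, Real.rpow_neg_one]

lemma hasDerivAt_boxCox (ξ : ℝ) {x : ℝ} (hx : 0 < x) :
    HasDerivAt (boxCox ξ) (x ^ (ξ - 1)) x := by
  by_cases hξ : ξ = 0
  · subst hξ
    have : boxCox 0 = Real.log := by ext; simp [boxCox]
    rw [this, zero_sub, Real.rpow_neg_one]
    exact Real.hasDerivAt_log hx.ne'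
  · have : boxCox ξ = fun x => (x ^ ξ - 1) / ξ := by ext; simp [boxCox, hξ]
    rw [this]
    have h := ((Real.hasDerivAt_rpow_const (p := ξ) (Or.inl hx.ne')).sub_const 1).div_const ξ
    rwa [mul_div_cancel_left₀ _ hξ] at h

lemma strictMonoOn_boxCox (ξ : ℝ) : StrictMonoOn (boxCox ξ) (Set.Ioi 0) := by
  refine strictMonoOn_of_deriv_pos (convex_Ioi 0)
    (fun x hx => (hasDerivAt_boxCox ξ hx).continuousAt.continuousWithinAt) fun x hx => ?_
  rw [interior_Ioi] at hx
  rw [(hasDerivAt_boxCox ξ hx).deriv]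
  exact Real.rpow_pos_of_pos hx _

/-- Every point of the support of `G_ξ` is a value of the Box-Cox function. -/
lemma exists_boxCox_eq {ξ z : ℝ} (hz : 0 < 1 + ξ * z) : ∃ x, 0 < x ∧ boxCox ξ x = z := by
  by_cases hξ : ξ = 0
  · exact ⟨Real.exp z, Real.exp_pos z, by simp [boxCox, hξ]⟩
  · refine ⟨(1 + ξ * z) ^ ξ⁻¹, by positivity, ?_⟩
    rw [boxCox, if_neg hξ, Real.rpow_inv_rpow hz.le hξ, add_sub_cancel_left,
      mul_div_cancel_left₀ _ hξ]

lemma hasDerivAt_gevCDF {ξ z : ℝ} (hz : 0 < 1 + ξ * z) :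
    HasDerivAt (gevCDF ξ) (if ξ = 0 then Real.exp (-Real.exp (-z)) * Real.exp (-z) else
      Real.exp (-(1 + ξ * z) ^ (-1 / ξ)) * (1 + ξ * z) ^ (-1 / ξ - 1)) z := by
  by_cases hξ : ξ = 0
  · have : gevCDF ξ = fun z => Real.exp (-Real.exp (-z)) := by ext; simp [gevCDF, hξ]
    rw [this, if_pos hξ]
    have h : HasDerivAt (fun z => Real.exp (-Real.exp (-z)))
        (Real.exp (-Real.exp (-z)) * -(Real.exp (-z) * -1)) z := (hasDerivAt_neg z).exp.neg.exp
    simpa using h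
  · rw [if_neg hξ]
    have hlin : HasDerivAt (fun z : ℝ => 1 + ξ * z) ξ z := by
      simpa using ((hasDerivAt_id z).const_mul ξ).const_add 1
    have h : HasDerivAt (fun z => Real.exp (-(1 + ξ * z) ^ (-1 / ξ)))
        (Real.exp (-(1 + ξ * z) ^ (-1 / ξ)) *
          -(ξ * (-1 / ξ) * (1 + ξ * z) ^ (-1 / ξ - 1))) z :=
      (hlin.rpow_const (p := -1 / ξ) (Or.inl hz.ne')).neg.exp
    have heq : gevCDF ξ =ᶠ[𝓝 z] fun z => Real.exp (-(1 + ξ * z) ^ (-1 / ξ)) := by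
      filter_upwards [hlin.continuousAt.eventually (lt_mem_nhds hz)] with y hy
      simp [gevCDF, hξ, hy]
    refine HasDerivAt.congr_of_eventuallyEq ?_ heq
    rwa [mul_div_cancel₀ _ hξ, neg_one_mul, neg_neg] at h

lemma deriv_gevCDF_boxCox (ξ : ℝ) {x : ℝ} (hx : 0 < x) :
    deriv (gevCDF ξ) (boxCox ξ x) = Real.exp (-x⁻¹) * x ^ (-1 - ξ) := by
  have hpos := one_add_mul_boxCox_pos ξ hx
  rw [(hasDerivAt_gevCDF hpos).deriv]
  by_cases hξ : ξ = 0
  · subst hξ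
    simp [boxCox, Real.exp_neg, Real.exp_log hx, Real.rpow_neg_one]
  · rw [if_neg hξ, one_add_mul_boxCox hξ, ← Real.rpow_mul hx.le, ← Real.rpow_mul hx.le,
      mul_div_cancel₀ _ hξ, Real.rpow_neg_one]
    congr 2
    field_simp

/-! ### Existence of auxiliary functions -/

lemma tendsto_one_sub_inv_mul_pow {x : ℝ} :
    Tendsto (fun n : ℕ => (1 - ((n : ℝ) * x)⁻¹) ^ n) atTop (𝓝 (Real.exp (-x⁻¹))) := by
  refine (Real.tendsto_one_add_div_pow_exp (-x⁻¹)).congr fun n => ?_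
  rw [mul_inv]; ring

section

variable (μ : Measure ℝ) {ξ : ℝ} {a b : ℕ → ℝ}

/-- Normalised maxima converging to `G_ξ` force the normalised tail quantile function to converge
along the integers. -/
lemma tendsto_tailQuantile_natCast (ha : ∀ n, 0 < a n)
    (h : ∀ z : ℝ, ContinuousAt (gevCDF ξ) z →
      Tendsto (fun n : ℕ => cdf μ (a n * z + b n) ^ n) atTop (𝓝 (gevCDF ξ z)))
    {x : ℝ} (hx : 0 < x) :
    Tendsto (fun n : ℕ => (tailQuantile (cdf μ) (n * x) - b n) / a n) atTop
      (𝓝 (boxCox ξ x)) := by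
  have hlarge : ∀ᶠ n : ℕ in atTop, 1 < (n : ℝ) * x :=
    (tendsto_natCast_atTop_atTop.atTop_mul_const hx).eventually_gt_atTop 1
  have hG : ∀ y, 0 < y → Tendsto (fun n : ℕ => cdf μ (a n * boxCox ξ y + b n) ^ n) atTop
      (𝓝 (Real.exp (-y⁻¹))) := fun y hy => by
    rw [← gevCDF_boxCox ξ hy]
    exact h _ (hasDerivAt_gevCDF (one_add_mul_boxCox_pos ξ hy)).continuousAt
  have hcont := (hasDerivAt_boxCox ξ hx).continuousAt
  refine tendsto_order.2 ⟨fun z hz => ?_, fun z hz => ?_⟩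
  -- Moving from x to a nearby y makes the limits of the two n-th powers strictly ordered, so the
  -- powers, and then their bases, are eventually ordered too.
  · obtain ⟨y, ⟨hzy, hy⟩, hyx⟩ :=
      (((hcont.eventually (lt_mem_nhds hz)).and (lt_mem_nhds hx)).filter_mono
        (nhdsWithin_le_nhds (s := Set.Iio x))).and self_mem_nhdsWithin |>.exists
    have hlt : Real.exp (-y⁻¹) < Real.exp (-x⁻¹) :=
      Real.exp_lt_exp.2 (neg_lt_neg (inv_strictAnti₀ hy hyx))
    filter_upwards [(hG y hy).eventually_lt (tendsto_one_sub_inv_mul_pow (x := x)) hlt, hlarge]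
      with n hn hn1
    have hinv : ((n : ℝ) * x)⁻¹ < 1 := inv_lt_one_of_one_lt₀ hn1
    have hF := lt_of_pow_lt_pow_left₀ n (by linarith) hn
    have := (lt_tailQuantile_iff μ hn1 _).2 hF
    rw [lt_div_iff₀ (ha n)]
    nlinarith [mul_lt_mul_of_pos_left hzy (ha n)]
  · obtain ⟨y, ⟨hzy, hy⟩, hyx⟩ :=
      (((hcont.eventually (gt_mem_nhds hz)).and (lt_mem_nhds hx)).filter_mono
        (nhdsWithin_le_nhds (s := Set.Ioi x))).and self_mem_nhdsWithin |>.exists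
    have hlt : Real.exp (-x⁻¹) < Real.exp (-y⁻¹) :=
      Real.exp_lt_exp.2 (neg_lt_neg (inv_strictAnti₀ hx hyx))
    filter_upwards [(tendsto_one_sub_inv_mul_pow (x := x)).eventually_lt (hG y hy) hlt, hlarge]
      with n hn hn1
    have hF := lt_of_pow_lt_pow_left₀ n (cdf_nonneg μ _) hn
    have := (tailQuantile_le_iff μ hn1 _).2 hF.le
    rw [div_lt_iff₀ (ha n)]
    nlinarith [mul_lt_mul_of_pos_left hzy (ha n)]

/-- Monotonicity of U sandwiches U(tx): it is at least U(⌊t⌋x), and at most U(⌊t⌋y) for any y > x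
once t is large, since ⌊t⌋/t → 1. Continuity of the limit in x closes the gap. -/
lemma tendsto_tailQuantile_floor (ha : ∀ n, 0 < a n)
    (h : ∀ x : ℝ, 0 < x → Tendsto (fun n : ℕ => (tailQuantile (cdf μ) (n * x) - b n) / a n) atTop
      (𝓝 (boxCox ξ x))) {x : ℝ} (hx : 0 < x) :
    Tendsto (fun t : ℝ => (tailQuantile (cdf μ) (t * x) - b ⌊t⌋₊) / a ⌊t⌋₊) atTop
      (𝓝 (boxCox ξ x)) := by
  have hfl : ∀ y, 0 < y → Tendsto
      (fun t : ℝ => (tailQuantile (cdf μ) (⌊t⌋₊ * y) - b ⌊t⌋₊) / a ⌊t⌋₊) atTop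
      (𝓝 (boxCox ξ y)) := fun y hy => (h y hy).comp tendsto_nat_floor_atTop
  have hlarge : ∀ᶠ t : ℝ in atTop, 1 < (⌊t⌋₊ : ℝ) * x :=
    ((tendsto_natCast_atTop_atTop.atTop_mul_const hx).comp
      tendsto_nat_floor_atTop).eventually_gt_atTop 1
  refine tendsto_order.2 ⟨fun z hz => ?_, fun z hz => ?_⟩
  · filter_upwards [(hfl x hx).eventually (lt_mem_nhds hz), hlarge, eventually_ge_atTop 0]
      with t ht ht1 ht0
    refine ht.trans_le ?_
    have := ha ⌊t⌋₊
    have := tailQuantile_mono μ ht1 (mul_le_mul_of_nonneg_right (Nat.floor_le ht0) hx.le)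
    gcongr
  · obtain ⟨y, hzy, hyx⟩ :=
      (((hasDerivAt_boxCox ξ hx).continuousAt.eventually (gt_mem_nhds hz)).filter_mono
        (nhdsWithin_le_nhds (s := Set.Ioi x))).and self_mem_nhdsWithin |>.exists
    have hyx : x < y := hyx
    have hratio : ∀ᶠ t : ℝ in atTop, x ≤ (⌊t⌋₊ : ℝ) / t * y := by
      have : Tendsto (fun t : ℝ => (⌊t⌋₊ : ℝ) / t * y) atTop (𝓝 (1 * y)) :=
        (tendsto_nat_floor_div_atTop (R := ℝ)).mul_const y
      filter_upwards [this.eventually (lt_mem_nhds (by rwa [one_mul] : x < 1 * y))] with t ht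
        using ht.le
    filter_upwards [(hfl y (hx.trans hyx)).eventually (gt_mem_nhds hzy), hlarge, hratio,
      eventually_gt_atTop 0] with t ht ht1 htr ht0
    refine lt_of_le_of_lt ?_ ht
    have h1 : t * x ≤ ⌊t⌋₊ * y := by
      have := mul_le_mul_of_nonneg_left htr ht0.le
      rwa [← mul_assoc, mul_div_cancel₀ _ ht0.ne'] at this
    have h2 : 1 < t * x := ht1.trans_le (mul_le_mul_of_nonneg_right (Nat.floor_le ht0.le) hx.le)
    have := ha ⌊t⌋₊
    have := tailQuantile_mono μ h2 h1
    gcongr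

theorem InMaxDomain.exists_isAuxiliary (h : InMaxDomain (cdf μ) (gevCDF ξ)) :
    ∃ a : ℝ → ℝ, IsAuxiliary (cdf μ) ξ a := by
  obtain ⟨a, b, ha, hab⟩ := h
  refine ⟨fun t => a ⌊t⌋₊, fun t _ => ha _, fun x hx => ?_⟩
  have hlim : ∀ y : ℝ, 0 < y → _ := fun y hy =>
    tendsto_tailQuantile_floor μ ha (fun x hx => tendsto_tailQuantile_natCast μ ha hab hx) hy
  -- Subtracting the limit at 1, which is 0, cancels the centring b.
  have := (hlim x hx).sub (hlim 1 one_pos)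
  rw [boxCox_one, sub_zero] at this
  refine this.congr fun t => ?_
  rw [mul_one]; ring

end

/-! ### Potter bounds from dyadic increments -/

/-- Geometric growth bounds for a function whose dyadic increments grow at most
geometrically. -/
lemma sub_le_of_dyadic_increments_le {U : ℝ → ℝ} {t₀ r : ℝ} (ht₀ : 0 < t₀) (hr : 1 < r)
    (h : ∀ t, t₀ ≤ t → U (4 * t) - U (2 * t) ≤ r * (U (2 * t) - U t)) (k : ℕ) :
    ∀ t, t₀ ≤ t → U (2 ^ k * t) - U t ≤ (r ^ k - 1) / (r - 1) * (U (2 * t) - U t) := by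
  have hr' : 0 < r - 1 := by linarith
  induction k with
  | zero => intro t _; simp
  | succ k ih =>
    intro t ht
    have h1 := ih (2 * t) (by linarith)
    have hK : 0 ≤ (r ^ k - 1) / (r - 1) :=
      div_nonneg (sub_nonneg.2 (one_le_pow₀ hr.le)) hr'.le
    have h2 := mul_le_mul_of_nonneg_left (h t ht) hK
    have e1 : (2 : ℝ) ^ (k + 1) * t = 2 ^ k * (2 * t) := by ring
    have e2 : (2 : ℝ) * (2 * t) = 4 * t := by ring
    rw [e2] at h1
    rw [e1]
    have e3 : (r ^ (k + 1) - 1) / (r - 1) * (U (2 * t) - U t) =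
        (r ^ k - 1) / (r - 1) * (r * (U (2 * t) - U t)) + (U (2 * t) - U t) := by
      field_simp; ring
    rw [e3]
    linarith

/-- Looking back from 2^k s, the increments are at most q, q², …, q^k times the one starting there;
the constant is the sum of this geometric series. -/
lemma sub_le_of_le_dyadic_increments {U : ℝ → ℝ} {t₀ q : ℝ} (ht₀ : 0 < t₀) (hq : 1 < q)
    (h : ∀ t, t₀ ≤ t → U (2 * t) - U t ≤ q * (U (4 * t) - U (2 * t))) (k : ℕ) :
    ∀ s, t₀ ≤ s → U (2 ^ k * s) - U s ≤
      q * (q ^ k - 1) / (q - 1) * (U (2 * (2 ^ k * s)) - U (2 ^ k * s)) := by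
  have hq' : 0 < q - 1 := by linarith
  induction k with
  | zero => intro s _; simp
  | succ k ih =>
    intro s hs
    have h1 := ih s hs
    have h2s : t₀ ≤ 2 ^ k * s := hs.trans (le_mul_of_one_le_left (by linarith)
      (one_le_pow₀ one_le_two))
    have h2 := h _ h2s
    have hK : 0 ≤ q * (q ^ k - 1) / (q - 1) :=
      div_nonneg (mul_nonneg (by linarith) (sub_nonneg.2 (one_le_pow₀ hq.le))) hq'.le
    have h3 := mul_le_mul_of_nonneg_left h2 hK
    have e1 : (2 : ℝ) ^ (k + 1) * s = 2 * (2 ^ k * s) := by ring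
    have e2 : (2 : ℝ) * (2 * (2 ^ k * s)) = 4 * (2 ^ k * s) := by ring
    rw [e1, e2]
    set v := 2 ^ k * s
    have e3 : q * (q ^ (k + 1) - 1) / (q - 1) * (U (4 * v) - U (2 * v)) =
        q * (q ^ k - 1) / (q - 1) * (q * (U (4 * v) - U (2 * v))) +
          q * (U (4 * v) - U (2 * v)) := by
      field_simp; ring
    rw [e3]
    linarith

/-- Applied at the bottom of a dyadic chain, this keeps the increment at the top from being too
small. -/
lemma increment_le_pow_mul {U : ℝ → ℝ} {t₀ q : ℝ} (ht₀ : 0 < t₀) (hq : 1 < q)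
    (h : ∀ t, t₀ ≤ t → U (2 * t) - U t ≤ q * (U (4 * t) - U (2 * t))) (k : ℕ) :
    ∀ s, t₀ ≤ s → U (2 * s) - U s ≤ q ^ k * (U (2 * (2 ^ k * s)) - U (2 ^ k * s)) := by
  induction k with
  | zero => intro s _; simp
  | succ k ih =>
    intro s hs
    have h1 := ih s hs
    have h2 := h _ (hs.trans (le_mul_of_one_le_left (by linarith)
      (one_le_pow₀ (one_le_two (α := ℝ)) (n := k))))
    have h3 := mul_le_mul_of_nonneg_left h2 (by positivity : 0 ≤ q ^ k)
    have e1 : (2 : ℝ) ^ (k + 1) * s = 2 * (2 ^ k * s) := by ring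
    have e2 : (2 : ℝ) * (2 * (2 ^ k * s)) = 4 * (2 ^ k * s) := by ring
    rw [e1, e2, pow_succ]
    linarith

lemma exists_nat_two_pow_near {y : ℝ} (hy : 1 ≤ y) :
    ∃ k : ℕ, (2 : ℝ) ^ k ≤ y ∧ y < 2 * 2 ^ k := by
  obtain ⟨k, h1, h2⟩ := exists_nat_pow_near hy one_lt_two
  exact ⟨k, h1, by rwa [pow_succ'] at h2⟩

lemma two_rpow_pow_le {p y : ℝ} (hp : 0 ≤ p) {k : ℕ} (h : (2 : ℝ) ^ k ≤ y) :
    ((2 : ℝ) ^ p) ^ k ≤ y ^ p := by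
  rw [← Real.rpow_natCast, ← Real.rpow_mul zero_le_two, mul_comm, Real.rpow_mul zero_le_two,
    Real.rpow_natCast]
  exact Real.rpow_le_rpow (by positivity) h hp

/-- A Potter bound above the reference point. -/
lemma sub_le_mul_rpow_of_dyadic {U : ℝ → ℝ} {t₀ ρ : ℝ} (ht₀ : 0 < t₀) (hρ : 0 < ρ)
    (hmono : MonotoneOn U (Set.Ici t₀))
    (h : ∀ t, t₀ ≤ t → U (4 * t) - U (2 * t) ≤ 2 ^ ρ * (U (2 * t) - U t)) {t y : ℝ}
    (ht : t₀ ≤ t) (hy : 1 ≤ y) :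
    U (t * y) - U t ≤ 2 ^ ρ / (2 ^ ρ - 1) * y ^ ρ * (U (2 * t) - U t) := by
  have ht0 : 0 < t := by linarith
  obtain ⟨k, hk1, hk2⟩ := exists_nat_two_pow_near hy
  have hr : (1 : ℝ) < 2 ^ ρ := Real.one_lt_rpow one_lt_two hρ
  have hr' : (0 : ℝ) < 2 ^ ρ - 1 := by linarith
  have h1 := sub_le_of_dyadic_increments_le ht₀ hr h (k + 1) t ht
  have h2 : U (t * y) ≤ U (2 ^ (k + 1) * t) := by
    apply hmono
    · exact ht.trans (le_mul_of_one_le_right ht0.le hy)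
    · exact ht.trans (le_mul_of_one_le_left ht0.le (one_le_pow₀ one_le_two))
    · rw [mul_comm, pow_succ']; gcongr
  have hV : 0 ≤ U (2 * t) - U t :=
    sub_nonneg.2 (hmono ht (show t₀ ≤ 2 * t by linarith) (by linarith))
  have h3 := two_rpow_pow_le hρ.le hk1
  calc U (t * y) - U t ≤ _ := (sub_le_sub_right h2 _).trans h1
    _ ≤ _ := by
      refine mul_le_mul_of_nonneg_right ?_ hV
      rw [div_mul_eq_mul_div]
      gcongr
      rw [pow_succ']
      nlinarith

/-- A Potter bound below the reference point, including arguments that have left the domain where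
the increments are controlled. -/
lemma exists_sub_le_mul_rpow_of_dyadic {U : ℝ → ℝ} {t₀ x ρ M : ℝ} (ht₀ : 1 < t₀) (hM : 0 < M)
    (hmono : MonotoneOn U (Set.Ioi 1)) (hx : x ≤ U t₀) (hpos : U (2 * t₀) < U (4 * t₀))
    (h : ∀ t, t₀ ≤ t → U (4 * t) - U (2 * t) ≤ 2 ^ ρ * (U (2 * t) - U t))
    (h' : ∀ t, t₀ ≤ t → U (2 * t) - U t ≤ 2 ^ M * (U (4 * t) - U (2 * t))) :
    ∃ C, 0 ≤ C ∧ ∀ t y, t₀ ≤ t → 1 ≤ y →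
      U t - max (U (t / y)) x ≤ C * y ^ M * (U (2 * t) - U t) := by
  have ht0 : 0 < t₀ := by linarith
  have hq : (1 : ℝ) < 2 ^ M := Real.one_lt_rpow one_lt_two hM
  have hq' : (0 : ℝ) < 2 ^ M - 1 := by linarith
  set q : ℝ := 2 ^ M
  have hmono₀ : ∀ s t, t₀ ≤ s → s ≤ t → U s ≤ U t := fun s t hs hst =>
    hmono (show 1 < s by linarith) (show 1 < t by linarith) hst
  -- A lower bound for U(2s) - U(s) on [t₀, 2t₀): there U(4t₀) - U(2t₀) ≤ U(4s) - U(s) ≤ (1 +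
  -- 2^ρ)(U(2s) - U(s)).
  set c : ℝ := (U (4 * t₀) - U (2 * t₀)) / (1 + 2 ^ ρ)
  have hr0 : (0 : ℝ) < 2 ^ ρ := by positivity
  have hc : 0 < c := div_pos (by linarith) (by linarith)
  have hcV : ∀ s, t₀ ≤ s → s < 2 * t₀ → c ≤ U (2 * s) - U s := fun s h1 h2 => by
    rw [div_le_iff₀ (by linarith)]
    have := h s h1
    have := hmono₀ (4 * t₀) (4 * s) (by linarith) (by linarith)
    have := hmono₀ s (2 * t₀) h1 h2.le
    nlinarith
  have hK0 : 0 ≤ q / (q - 1) := by positivity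
  have hD : 0 ≤ (U (2 * t₀) - x) / c :=
    div_nonneg (by linarith [hmono₀ t₀ (2 * t₀) le_rfl (by linarith)]) hc.le
  -- The first term is the geometric series, the second the stretch cut off by x; the extra factor q
  -- pays for rounding y to a power of 2.
  refine ⟨q * (q / (q - 1)) + q * ((U (2 * t₀) - x) / c), by positivity,
    fun t y ht hy => ?_⟩
  have hy0 : 0 < y := by linarith
  have htt : 0 < t := by linarith
  have hV : 0 ≤ U (2 * t) - U t := sub_nonneg.2 (hmono₀ _ _ ht (by linarith))
  have hKq : ∀ k : ℕ, q * (q ^ k - 1) / (q - 1) ≤ q / (q - 1) * q ^ k := fun k => by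
    rw [div_mul_eq_mul_div]
    gcongr
    linarith
  have hKqV : ∀ k : ℕ, ∀ s, t₀ ≤ s → 2 ^ k * s = t →
      U t - U s ≤ q / (q - 1) * q ^ k * (U (2 * t) - U t) := fun k s hs hst => by
    have := sub_le_of_le_dyadic_increments ht0 hq h' k s hs
    rw [hst] at this
    exact this.trans (mul_le_mul_of_nonneg_right (hKq k) hV)
  have hyM : 0 < y ^ M := by positivity
  obtain ⟨k, hk1, hk2⟩ := exists_nat_two_pow_near hy
  have hqk := two_rpow_pow_le hM.le hk1
  by_cases hcase : t₀ ≤ t / 2 ^ (k + 1)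
  · have h1 := hKqV (k + 1) (t / 2 ^ (k + 1)) hcase (by field_simp)
    have h2 : U (t / 2 ^ (k + 1)) ≤ U (t / y) := by
      apply hmono₀ _ _ hcase
      have : y ≤ 2 ^ (k + 1) := by rw [pow_succ']; exact hk2.le
      gcongr
    calc U t - max (U (t / y)) x ≤ U t - U (t / 2 ^ (k + 1)) := by
          linarith [le_max_left (U (t / y)) x]
      _ ≤ _ := h1
      _ ≤ _ := by
        refine mul_le_mul_of_nonneg_right ?_ hV
        rw [pow_succ']
        have : q / (q - 1) * (q * q ^ k) ≤ q * (q / (q - 1)) * y ^ M := by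
          calc _ = q * (q / (q - 1)) * q ^ k := by ring
            _ ≤ _ := by gcongr
        have : 0 ≤ q * ((U (2 * t₀) - x) / c) * y ^ M := by positivity
        nlinarith
  -- Here t/y may lie below t₀. Halve t only j times, to land in [t₀, 2t₀); the remaining drop is at
  -- most U(2t₀) - x, a constant comparable to c.
  · obtain ⟨j, hj1, hj2⟩ := exists_nat_two_pow_near ((one_le_div ht0).2 ht)
    have hs1 : t₀ ≤ t / 2 ^ j := by
      rw [le_div_iff₀ (by positivity)]
      rw [le_div_iff₀ ht0] at hj1
      linarith
    have hs2 : t / 2 ^ j < 2 * t₀ := by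
      rw [div_lt_iff₀ (by positivity)]
      rw [div_lt_iff₀ ht0] at hj2
      linarith
    have hjk : (2 : ℝ) ^ j ≤ y * 2 := by
      rw [le_div_iff₀ (by positivity)] at hcase
      rw [le_div_iff₀ ht0] at hj1
      rw [pow_succ'] at hcase
      have : 2 ^ j * t₀ < 2 * 2 ^ k * t₀ := by linarith
      have := lt_of_mul_lt_mul_right this ht0.le
      linarith
    have hqj : q ^ j ≤ q * y ^ M := by
      have := two_rpow_pow_le hM.le hjk
      rw [Real.mul_rpow hy0.le zero_le_two] at this
      linarith
    have hst : 2 ^ j * (t / 2 ^ j) = t := by field_simp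
    have h1 := hKqV j _ hs1 hst
    have h2 := increment_le_pow_mul ht0 hq h' j _ hs1
    rw [hst] at h2
    have h3 : U (t / 2 ^ j) - x ≤ (U (2 * t₀) - x) / c * (q ^ j * (U (2 * t) - U t)) := by
      calc U (t / 2 ^ j) - x ≤ U (2 * t₀) - x := by
            linarith [hmono₀ (t / 2 ^ j) (2 * t₀) hs1 hs2.le]
        _ = (U (2 * t₀) - x) / c * c := by field_simp
        _ ≤ _ := by
          refine mul_le_mul_of_nonneg_left ((hcV _ hs1 hs2).trans h2) hD
    calc U t - max (U (t / y)) x ≤ (U t - U (t / 2 ^ j)) + (U (t / 2 ^ j) - x) := by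
          linarith [le_max_right (U (t / y)) x]
      _ ≤ _ := add_le_add h1 h3
      _ = (q / (q - 1) + (U (2 * t₀) - x) / c) * q ^ j * (U (2 * t) - U t) := by ring
      _ ≤ (q / (q - 1) + (U (2 * t₀) - x) / c) * (q * y ^ M) * (U (2 * t) - U t) := by
        gcongr
      _ = _ := by ring

/-! ### The Potter bound relative to an auxiliary function -/

lemma boxCox_inv (ξ : ℝ) {x : ℝ} (hx : 0 < x) : boxCox ξ x⁻¹ = -boxCox (-ξ) x := by
  by_cases hξ : ξ = 0
  · simp [boxCox, hξ]
  · rw [boxCox, boxCox, if_neg hξ, if_neg (neg_ne_zero.2 hξ), Real.inv_rpow hx.le,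
      Real.rpow_neg hx.le, div_neg, neg_neg]

lemma boxCox_mul (ξ : ℝ) {x y : ℝ} (hx : 0 < x) (hy : 0 < y) :
    boxCox ξ (x * y) = boxCox ξ x + x ^ ξ * boxCox ξ y := by
  by_cases hξ : ξ = 0
  · simp [boxCox, hξ, Real.log_mul hx.ne' hy.ne']
  · simp only [boxCox, if_neg hξ, Real.mul_rpow hx.le hy.le]
    ring

lemma boxCox_two_pos (ξ : ℝ) : 0 < boxCox ξ 2 := by
  rw [← boxCox_one ξ]
  exact strictMonoOn_boxCox ξ (Set.mem_Ioi.2 one_pos) (Set.mem_Ioi.2 two_pos) one_lt_two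

/-- A two-sided Potter bound for the truncated tail quantile function of a distribution possessing
an auxiliary function. -/
lemma IsAuxiliary.exists_abs_sub_le (μ : Measure ℝ) {ξ : ℝ} (hξ : ξ < 1) {a : ℝ → ℝ}
    (ha : IsAuxiliary (cdf μ) ξ a) {x : ℝ} (hx : (x : EReal) < rightEndpoint (cdf μ)) :
    ∃ C ρ M t₀ : ℝ, ρ < 1 ∧ 0 < M ∧ 1 < t₀ ∧ ∀ t s, t₀ ≤ t → 0 < s → s < t →
      |max (tailQuantile (cdf μ) (t / s)) x - tailQuantile (cdf μ) t| ≤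
        C * (s ^ (-ρ) + s ^ M) * a t := by
  obtain ⟨hapos, hlim⟩ := ha
  set U := tailQuantile (cdf μ)
  set D := boxCox ξ 2
  have hD : 0 < D := boxCox_two_pos ξ
  have hD4 : boxCox ξ 4 = D + 2 ^ ξ * D := by
    rw [show (4 : ℝ) = 2 * 2 by norm_num, boxCox_mul ξ two_pos two_pos]
  -- ρ > ξ and M > -ξ leave room around the limiting ratio 2^ξ; positivity makes the geometric
  -- ratios exceed 1; ρ < 1 keeps s^(-ρ) integrable at 0.
  obtain ⟨ρ, hρ, hρ1⟩ := exists_between (max_lt hξ one_pos)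
  obtain ⟨hρξ, hρ0⟩ := max_lt_iff.1 hρ
  obtain ⟨M, hM⟩ := exists_gt (max (-ξ) 0)
  obtain ⟨hMξ, hM0⟩ := max_lt_iff.1 hM
  have hV : Tendsto (fun t => (U (2 * t) - U t) / a t) atTop (𝓝 D) :=
    (hlim 2 two_pos).congr fun t => by rw [mul_comm]
  have hW : Tendsto (fun t => (U (4 * t) - U (2 * t)) / a t) atTop (𝓝 (2 ^ ξ * D)) := by
    have := (hlim 4 four_pos).sub (hlim 2 two_pos)
    rw [hD4, add_sub_cancel_left] at this
    refine this.congr fun t => ?_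
    rw [mul_comm t 4, mul_comm t 2]; ring
  have h1 : 2 ^ ξ * D < 2 ^ ρ * D :=
    mul_lt_mul_of_pos_right (Real.rpow_lt_rpow_of_exponent_lt one_lt_two hρξ) hD
  have h2 : D < 2 ^ M * (2 ^ ξ * D) := by
    rw [← mul_assoc, ← Real.rpow_add two_pos]
    exact lt_mul_of_one_lt_left hD (Real.one_lt_rpow one_lt_two (by linarith))
  obtain ⟨t₀, ht₀⟩ := eventually_atTop.1
    ((hW.eventually_lt (hV.const_mul _) h1).and <| (hV.eventually_lt (hW.const_mul _) h2).and <|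
      (hW.eventually (lt_mem_nhds (show 0 < 2 ^ ξ * D by positivity))).and <|
      (hV.eventually (gt_mem_nhds (lt_add_one D))).and <|
      (eventually_lt_tailQuantile μ hx).and (eventually_gt_atTop 1))
  have hmono : ∀ s t, 1 < s → s ≤ t → U s ≤ U t := fun s t => tailQuantile_mono μ
  have hat : ∀ t, t₀ ≤ t → 0 < a t := fun t ht => hapos t (ht₀ t ht).2.2.2.2.2.le
  have ht₀1 : 1 < t₀ := (ht₀ t₀ le_rfl).2.2.2.2.2
  have hdyad : ∀ t, t₀ ≤ t → U (4 * t) - U (2 * t) ≤ 2 ^ ρ * (U (2 * t) - U t) := fun t ht => by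
    have := (ht₀ t ht).1
    rw [← mul_div_assoc, div_lt_div_iff_of_pos_right (hat t ht)] at this
    exact this.le
  have hdyad' : ∀ t, t₀ ≤ t → U (2 * t) - U t ≤ 2 ^ M * (U (4 * t) - U (2 * t)) :=
    fun t ht => by
    have := (ht₀ t ht).2.1
    rw [← mul_div_assoc, div_lt_div_iff_of_pos_right (hat t ht)] at this
    exact this.le
  have hpos : U (2 * t₀) < U (4 * t₀) := by
    have := (ht₀ t₀ le_rfl).2.2.1
    rw [div_pos_iff_of_pos_right (hat t₀ le_rfl)] at this
    linarith
  have hVa : ∀ t, t₀ ≤ t → U (2 * t) - U t ≤ (D + 1) * a t := fun t ht => by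
    have := (ht₀ t ht).2.2.2.1
    rw [div_lt_iff₀ (hat t ht)] at this
    exact this.le
  obtain ⟨C, hC, hlow⟩ := exists_sub_le_mul_rpow_of_dyadic (U := U) (x := x) ht₀1 hM0
    (fun s hs t _ hst => hmono s t hs hst) (ht₀ t₀ le_rfl).2.2.2.2.1.le hpos hdyad hdyad'
  set K : ℝ := 2 ^ ρ / (2 ^ ρ - 1)
  have hK : 0 ≤ K := by
    have : (1 : ℝ) < 2 ^ ρ := Real.one_lt_rpow one_lt_two hρ0
    exact div_nonneg (by linarith) (by linarith)
  refine ⟨(K + C) * (D + 1), ρ, M, t₀, hρ1, hM0, ht₀1, fun t s ht hs hst => ?_⟩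
  have ht0 : 0 < t := by linarith
  have hxt : x < U t := (ht₀ t ht).2.2.2.2.1
  have hsρ : 0 < s ^ (-ρ) := by positivity
  have hsM : 0 < s ^ M := by positivity
  have hV0 : 0 ≤ U (2 * t) - U t := sub_nonneg.2 (hmono _ _ (by linarith) (by linarith))
  suffices h : |max (U (t / s)) x - U t| ≤ (K + C) * (s ^ (-ρ) + s ^ M) * (U (2 * t) - U t) by
    refine h.trans ?_
    calc _ ≤ (K + C) * (s ^ (-ρ) + s ^ M) * ((D + 1) * a t) :=
          mul_le_mul_of_nonneg_left (hVa t ht) (by positivity)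
      _ = _ := by ring
  -- For s ≤ 1 the argument t/s lies above t and the upper bound applies with y = 1/s; otherwise the
  -- lower one applies with y = s.
  rcases le_total s 1 with hs1 | hs1
  · have h3 : U t ≤ U (t / s) :=
      hmono _ _ (by linarith) (le_div_self ht0.le hs hs1)
    rw [max_eq_left (hxt.le.trans h3), abs_of_nonneg (sub_nonneg.2 h3)]
    have h4 := sub_le_mul_rpow_of_dyadic (U := U) (by linarith) hρ0
      (fun s (hs : t₀ ≤ s) t _ hst => hmono s t (by linarith) hst) hdyad ht
      ((one_le_inv₀ hs).2 hs1)
    rw [← div_eq_mul_inv, Real.inv_rpow hs.le, ← Real.rpow_neg hs.le] at h4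
    refine h4.trans (mul_le_mul_of_nonneg_right ?_ hV0)
    nlinarith [mul_nonneg hK hsM.le, mul_nonneg hC hsM.le, mul_nonneg hC hsρ.le]
  · have h3 : max (U (t / s)) x ≤ U t :=
      max_le (hmono _ _ ((one_lt_div hs).2 hst) (div_le_self ht0.le hs1)) hxt.le
    rw [abs_of_nonpos (sub_nonpos.2 h3), neg_sub]
    refine (hlow t s ht hs1).trans (mul_le_mul_of_nonneg_right ?_ hV0)
    nlinarith [mul_nonneg hK hsM.le, mul_nonneg hK hsρ.le, mul_nonneg hC hsρ.le]

/-! ### Quantile representation of the maximum -/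

/-- The law on `(0, n)` with density `(1 - s / n) ^ (n - 1)`, that is, of `n` times a minimum of
`n` independent uniform variables. -/
noncomputable def uniformMinLaw (n : ℕ) : Measure ℝ :=
  (volume.restrict (Set.Ioo 0 (n : ℝ))).withDensity
    fun s => ((Real.toNNReal ((1 - s / n) ^ (n - 1)) : NNReal) : ENNReal)

lemma integral_one_sub_div_pow {n : ℕ} (hn : 1 ≤ n) (c : ℝ) :
    ∫ s in c..n, (1 - s / n) ^ (n - 1) = (1 - c / n) ^ n := by
  have hn0 : (n : ℝ) ≠ 0 := by positivity
  have hderiv : ∀ s ∈ Set.uIcc c n,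
      HasDerivAt (fun s : ℝ => -(1 - s / n) ^ n) ((1 - s / n) ^ (n - 1)) s := fun s _ => by
    have h : HasDerivAt (fun s : ℝ => -(1 - s / n) ^ n)
        (-(n * (1 - s / n) ^ (n - 1) * -(1 / n))) s :=
      ((((hasDerivAt_id s).div_const (n : ℝ)).const_sub 1).pow n).neg
    have e : -(n * (1 - s / n) ^ (n - 1) * -(1 / (n : ℝ))) = (1 - s / n) ^ (n - 1) := by
      field_simp
    rwa [e] at h
  rw [intervalIntegral.integral_eq_sub_of_hasDerivAt hderiv
    (Continuous.intervalIntegrable (by fun_prop) _ _), div_self hn0, sub_self,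
    zero_pow (by omega)]
  ring

lemma uniformMinLaw_Ioo_inter_Ici {n : ℕ} (hn : 1 ≤ n) {c : ℝ} (hc : 0 ≤ c) (hcn : c ≤ n) :
    uniformMinLaw n (Set.Ioo 0 (n : ℝ) ∩ Set.Ici c) = ENNReal.ofReal ((1 - c / n) ^ n) := by
  have hn0 : (0 : ℝ) < n := by positivity
  have hset : MeasurableSet (Set.Ioo 0 (n : ℝ) ∩ Set.Ici c) :=
    measurableSet_Ioo.inter measurableSet_Ici
  have hae : (Set.Ioo 0 (n : ℝ) ∩ Set.Ici c : Set ℝ) =ᵐ[volume] Set.Ioc c n := by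
    have h : ∀ s : ℝ, s ≠ c → s ≠ n →
        (s ∈ Set.Ioo 0 (n : ℝ) ∩ Set.Ici c ↔ s ∈ Set.Ioc c (n : ℝ)) := by
      intro s h1 h2
      simp only [Set.mem_inter_iff, Set.mem_Ioo, Set.mem_Ici, Set.mem_Ioc]
      constructor
      · rintro ⟨⟨_, h3⟩, h4⟩
        exact ⟨lt_of_le_of_ne h4 h1.symm, h3.le⟩
      · rintro ⟨h3, h4⟩
        exact ⟨⟨by linarith, lt_of_le_of_ne h4 h2⟩, h3.le⟩
    filter_upwards [Measure.ae_ne volume c, Measure.ae_ne volume (n : ℝ)] with s h1 h2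
    exact propext (h s h1 h2)
  rw [uniformMinLaw, withDensity_apply _ hset, Measure.restrict_restrict hset,
    Set.inter_right_comm, Set.inter_self, Measure.restrict_congr_set hae,
    ← integral_one_sub_div_pow hn c, intervalIntegral.integral_of_le hcn]
  symm
  refine ofReal_integral_eq_lintegral_ofReal ?_ ?_
  · exact (Continuous.integrableOn_Icc (by fun_prop)).mono_set Set.Ioc_subset_Icc_self
  · filter_upwards [ae_restrict_mem measurableSet_Ioc] with s hs
    have : s / n ≤ 1 := (div_le_one hn0).2 hs.2
    exact pow_nonneg (by linarith) _

lemma uniformMinLaw_absolutelyContinuous (n : ℕ) :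
    uniformMinLaw n ≪ volume.restrict (Set.Ioo 0 (n : ℝ)) :=
  withDensity_absolutelyContinuous _ _

section

variable (μ : Measure ℝ)

lemma aemeasurable_tailQuantile_div (n : ℕ) :
    AEMeasurable (fun s => tailQuantile (cdf μ) (n / s)) (volume.restrict (Set.Ioo 0 (n : ℝ))) := by
  refine aemeasurable_restrict_of_antitoneOn measurableSet_Ioo fun s hs t ht hst => ?_
  refine tailQuantile_mono μ ((one_lt_div ht.1).2 ht.2) ?_
  have := hs.1
  gcongr

/-- By the generalised inverse property the event is s ≥ n(1 - F(y)), whose mass is F(y)^n; F need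
not be continuous. -/
lemma map_uniformMinLaw_Iic {n : ℕ} (hn : 1 ≤ n) (y : ℝ) :
    (uniformMinLaw n).map (fun s => tailQuantile (cdf μ) (n / s)) (Set.Iic y) =
      ENNReal.ofReal (cdf μ y ^ n) := by
  have hn0 : (0 : ℝ) < n := by positivity
  have hac := uniformMinLaw_absolutelyContinuous n
  have hF0 := cdf_nonneg μ y
  have hF1 := cdf_le_one μ y
  rw [Measure.map_apply_of_aemeasurable ((aemeasurable_tailQuantile_div μ n).mono_ac hac)
    measurableSet_Iic]
  have hmem : ∀ᵐ s ∂(uniformMinLaw n), s ∈ Set.Ioo 0 (n : ℝ) :=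
    hac.ae_le (ae_restrict_mem measurableSet_Ioo)
  have hae : ((fun s => tailQuantile (cdf μ) (n / s)) ⁻¹' Set.Iic y : Set ℝ)
      =ᵐ[uniformMinLaw n] (Set.Ioo 0 (n : ℝ) ∩ Set.Ici (n * (1 - cdf μ y)) : Set ℝ) := by
    have h : ∀ s ∈ Set.Ioo 0 (n : ℝ),
        (s ∈ (fun s => tailQuantile (cdf μ) (n / s)) ⁻¹' Set.Iic y ↔
          s ∈ Set.Ioo 0 (n : ℝ) ∩ Set.Ici (n * (1 - cdf μ y))) := fun s hs => by
      rw [Set.mem_preimage, Set.mem_Iic, tailQuantile_le_iff μ ((one_lt_div hs.1).2 hs.2),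
        Set.mem_inter_iff, and_iff_right hs, Set.mem_Ici, inv_div, sub_le_comm, le_div_iff₀ hn0,
        mul_comm]
    filter_upwards [hmem] with s hs
    exact propext (h s hs)
  rw [measure_congr hae, uniformMinLaw_Ioo_inter_Ici hn
    (mul_nonneg hn0.le (by linarith)) (by nlinarith)]
  congr 2
  field_simp
  ring

end

/-! ### The law and integrability of the running maximum -/

section Maximum

variable {Ω : Type*} {X : ℕ → Ω → ℝ}

lemma runningMax_le_iff {n : ℕ} (hn : 1 ≤ n) (ω : Ω) (y : ℝ) :
    runningMax X n ω ≤ y ↔ ∀ i ∈ Finset.range n, X i ω ≤ y := by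
  have : Nonempty (Fin n) := ⟨⟨0, hn⟩⟩
  rw [runningMax, ciSup_le_iff (Set.finite_range _).bddAbove]
  exact ⟨fun h i hi => h ⟨i, Finset.mem_range.1 hi⟩, fun h i => h i (Finset.mem_range.2 i.2)⟩

lemma abs_runningMax_le {n : ℕ} (hn : 1 ≤ n) (ω : Ω) :
    |runningMax X n ω| ≤ ∑ i ∈ Finset.range n, |X i ω| := by
  have hle : ∀ i ∈ Finset.range n, |X i ω| ≤ ∑ i ∈ Finset.range n, |X i ω| := fun i hi =>
    Finset.single_le_sum (f := fun i => |X i ω|) (fun i _ => abs_nonneg _) hi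
  have h0 : 0 ∈ Finset.range n := Finset.mem_range.2 hn
  refine abs_le.2 ⟨?_, (runningMax_le_iff hn ω _).2 fun i hi => (le_abs_self _).trans (hle i hi)⟩
  calc _ ≤ -|X 0 ω| := neg_le_neg (hle 0 h0)
    _ ≤ X 0 ω := neg_abs_le _
    _ ≤ _ := (runningMax_le_iff hn ω _).1 le_rfl 0 h0

variable [MeasurableSpace Ω] {P : Measure Ω}

lemma measurable_runningMax (hmeas : ∀ i, Measurable (X i)) (n : ℕ) :
    Measurable (runningMax X n) :=
  Measurable.iSup fun i : Fin n => hmeas i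

lemma map_runningMax_Iic (hmeas : ∀ i, Measurable (X i)) (hindep : iIndepFun X P)
    {μ : Measure ℝ} [IsProbabilityMeasure μ] (hlaw : ∀ i, P.map (X i) = μ) {n : ℕ} (hn : 1 ≤ n)
    (y : ℝ) :
    P.map (runningMax X n) (Set.Iic y) = ENNReal.ofReal (cdf μ y ^ n) := by
  rw [Measure.map_apply (measurable_runningMax hmeas n) measurableSet_Iic]
  have hset : runningMax X n ⁻¹' Set.Iic y = ⋂ i ∈ Finset.range n, X i ⁻¹' Set.Iic y := by
    ext ω
    simp [runningMax_le_iff hn]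
  have hX : ∀ i, P (X i ⁻¹' Set.Iic y) = ENNReal.ofReal (cdf μ y) := fun i => by
    rw [← Measure.map_apply (hmeas i) measurableSet_Iic, hlaw i, ofReal_cdf]
  rw [hset, hindep.measure_inter_preimage_eq_mul (Finset.range n) fun _ _ => measurableSet_Iic,
    Finset.prod_congr rfl fun i _ => hX i, Finset.prod_const, Finset.card_range,
    ENNReal.ofReal_pow (cdf_nonneg μ y)]

lemma map_runningMax [IsProbabilityMeasure P] (hmeas : ∀ i, Measurable (X i))
    (hindep : iIndepFun X P) {μ : Measure ℝ} [IsProbabilityMeasure μ]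
    (hlaw : ∀ i, P.map (X i) = μ) {n : ℕ} (hn : 1 ≤ n) :
    P.map (runningMax X n) =
      (uniformMinLaw n).map fun s => tailQuantile (cdf μ) (n / s) := by
  have := Measure.isProbabilityMeasure_map (μ := P) (measurable_runningMax hmeas n).aemeasurable
  refine Measure.ext_of_Iic _ _ fun y => ?_
  rw [map_runningMax_Iic hmeas hindep hlaw hn, map_uniformMinLaw_Iic μ hn]

lemma integrable_max_runningMax_sub [IsProbabilityMeasure P] (hmeas : ∀ i, Measurable (X i))
    (hint : ∀ i, Integrable (X i) P) {n : ℕ} (hn : 1 ≤ n) (x : ℝ) :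
    Integrable (fun ω => max (runningMax X n ω - x) 0) P := by
  have hM : Integrable (runningMax X n) P := by
    refine Integrable.mono' (integrable_finsetSum (Finset.range n) fun i _ => (hint i).abs)
      (measurable_runningMax hmeas n).aestronglyMeasurable (ae_of_all _ fun ω => ?_)
    exact abs_runningMax_le hn ω
  exact (hM.sub (integrable_const x)).pos_part

end Maximum

/-! ### Gamma integrals and the mean of G_ξ -/

/-- Differentiating the Gamma integral under the integral sign at 1 identifies the integral with
Γ'(1) = -γ. -/
lemma integral_log_mul_exp_neg :
    ∫ s in Set.Ioi (0 : ℝ), Real.log s * Real.exp (-s) = -Real.eulerMascheroniConstant := by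
  have h1 := Complex.hasDerivAt_GammaIntegral (s := 1) (by simp)
  have h2 : HasDerivAt Complex.Gamma
      (∫ t : ℝ in Set.Ioi 0, (t : ℂ) ^ ((1 : ℂ) - 1) * (Real.log t * Real.exp (-t))) ((1 : ℝ) : ℂ) := by
    rw [Complex.ofReal_one]
    refine h1.congr_of_eventuallyEq ?_
    filter_upwards [(Complex.continuous_re.isOpen_preimage _ isOpen_Ioi).mem_nhds
      (show (1 : ℂ) ∈ Complex.re ⁻¹' Set.Ioi 0 by simp)] with a ha
      using Complex.Gamma_eq_integral ha
  have h3 : ∫ t : ℝ in Set.Ioi 0, (t : ℂ) ^ ((1 : ℂ) - 1) * (Real.log t * Real.exp (-t)) =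
      ((∫ s in Set.Ioi (0 : ℝ), Real.log s * Real.exp (-s) : ℝ) : ℂ) := by
    rw [← integral_complex_ofReal]
    simp
  rw [h3] at h2
  have h4 : HasDerivAt Real.Gamma (∫ s in Set.Ioi (0 : ℝ), Real.log s * Real.exp (-s)) 1 := by
    simpa [Complex.Gamma_ofReal] using h2.real_of_complex
  rw [Real.eulerMascheroniConstant_eq_neg_deriv, h4.deriv, neg_neg]

lemma integrableOn_rpow_mul_exp_neg {p : ℝ} (hp : -1 < p) :
    IntegrableOn (fun s : ℝ => s ^ p * Real.exp (-s)) (Set.Ioi 0) := by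
  have := Real.GammaIntegral_convergent (s := p + 1) (by linarith)
  simpa only [add_sub_cancel_right, mul_comm] using this

lemma integral_rpow_mul_exp_neg {p : ℝ} (hp : -1 < p) :
    ∫ s in Set.Ioi (0 : ℝ), s ^ p * Real.exp (-s) = Real.Gamma (p + 1) := by
  rw [Real.Gamma_eq_integral (by linarith)]
  simp only [add_sub_cancel_right, mul_comm]

lemma integrableOn_boxCox_mul_exp_neg {ξ : ℝ} (hξ : -1 < ξ) :
    IntegrableOn (fun s : ℝ => boxCox ξ s * Real.exp (-s)) (Set.Ioi 0) := by
  by_cases h : ξ = 0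
  · subst h
    -- A non-integrable function has integral 0 by convention, whereas this integral is -γ ≠ 0.
    by_contra hni
    have h1 : ∫ s in Set.Ioi (0 : ℝ), Real.log s * Real.exp (-s) = 0 :=
      integral_undef (by simpa [IntegrableOn, boxCox] using hni)
    rw [integral_log_mul_exp_neg] at h1
    linarith [Real.one_half_lt_eulerMascheroniConstant]
  · have h0 := integrableOn_rpow_mul_exp_neg (p := 0) (by norm_num)
    have := ((integrableOn_rpow_mul_exp_neg hξ).sub h0).div_const ξ
    refine this.congr (ae_of_all _ fun s => ?_)
    simp only [boxCox, if_neg h, Pi.sub_apply, Real.rpow_zero]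
    ring

lemma integral_boxCox_mul_exp_neg {ξ : ℝ} (hξ : -1 < ξ) :
    ∫ s in Set.Ioi (0 : ℝ), boxCox ξ s * Real.exp (-s) =
      if ξ = 0 then -Real.eulerMascheroniConstant else Real.Gamma ξ - 1 / ξ := by
  split_ifs with h
  · simpa [boxCox, h] using integral_log_mul_exp_neg
  · have h0 := integrableOn_rpow_mul_exp_neg (p := 0) (by norm_num)
    calc _ = ∫ s in Set.Ioi (0 : ℝ),
          (s ^ ξ * Real.exp (-s) - s ^ (0 : ℝ) * Real.exp (-s)) / ξ := by
          congr 1 with s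
          simp only [boxCox, if_neg h, Real.rpow_zero]
          ring
      _ = (Real.Gamma (ξ + 1) - Real.Gamma (0 + 1)) / ξ := by
          rw [integral_div, integral_sub (integrableOn_rpow_mul_exp_neg hξ) h0,
            integral_rpow_mul_exp_neg hξ, integral_rpow_mul_exp_neg (by norm_num)]
      _ = _ := by
          rw [Real.Gamma_add_one h, zero_add, Real.Gamma_one]
          field_simp

lemma deriv_gevCDF_eq_zero {ξ z : ℝ} (hz : 1 + ξ * z < 0) : deriv (gevCDF ξ) z = 0 := by
  have hξ : ξ ≠ 0 := by rintro rfl; simp at hz; linarith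
  have heq : gevCDF ξ =ᶠ[𝓝 z] fun _ => if 0 < ξ then 0 else 1 := by
    have hc : ContinuousAt (fun z : ℝ => 1 + ξ * z) z := by fun_prop
    filter_upwards [hc.eventually (gt_mem_nhds hz)] with y hy
    simp [gevCDF, hξ, hy.not_gt]
  rw [heq.deriv_eq, deriv_const]

lemma ae_deriv_gevCDF_eq_zero (ξ : ℝ) :
    ∀ᵐ z : ℝ, z ∉ {z : ℝ | 0 < 1 + ξ * z} → z * deriv (gevCDF ξ) z = 0 := by
  -- The discarded null point is the boundary of the support. For ξ = 0 it is 0 by convention, and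
  -- there is nothing outside the support to check.
  filter_upwards [Measure.ae_ne volume (-1 / ξ)] with z hz hzS
  rw [deriv_gevCDF_eq_zero, mul_zero]
  refine lt_of_le_of_ne (not_lt.1 hzS) fun h => hz ?_
  have hξ : ξ ≠ 0 := by rintro rfl; simp at h
  field_simp
  linarith

lemma image_neg_boxCox_neg (ξ : ℝ) :
    (fun s => -boxCox (-ξ) s) '' Set.Ioi 0 = {z : ℝ | 0 < 1 + ξ * z} := by
  ext z
  constructor
  · rintro ⟨s, hs, rfl⟩
    simpa using one_add_mul_boxCox_pos (-ξ) hs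
  · intro hz
    obtain ⟨s, hs, hsz⟩ := exists_boxCox_eq (ξ := -ξ) (z := -z) (by simpa using hz)
    exact ⟨s, hs, by simp [hsz]⟩

lemma hasDerivWithinAt_neg_boxCox_neg (ξ : ℝ) :
    ∀ s ∈ Set.Ioi (0 : ℝ),
      HasDerivWithinAt (fun s => -boxCox (-ξ) s) (-s ^ (-ξ - 1)) (Set.Ioi 0) s :=
  fun _ hs => (hasDerivAt_boxCox (-ξ) hs).neg.hasDerivWithinAt

lemma injOn_neg_boxCox_neg (ξ : ℝ) : Set.InjOn (fun s => -boxCox (-ξ) s) (Set.Ioi 0) :=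
  fun _ hs _ ht hst => (strictMonoOn_boxCox (-ξ)).injOn hs ht (neg_injective hst)

/-- Under z = `-boxCox (-ξ) s`, which is `boxCox ξ s⁻¹`, the Jacobian cancels the power of s in the
density of G_ξ and leaves the weight e^(-s). -/
lemma abs_deriv_smul_gevCDF (ξ : ℝ) {s : ℝ} (hs : 0 < s) :
    |-s ^ (-ξ - 1)| • (-boxCox (-ξ) s * deriv (gevCDF ξ) (-boxCox (-ξ) s)) =
      -(boxCox (-ξ) s * Real.exp (-s)) := by
  have h := deriv_gevCDF_boxCox ξ (inv_pos.2 hs)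
  rw [boxCox_inv ξ hs, inv_inv, Real.inv_rpow hs.le, ← Real.rpow_neg hs.le] at h
  have hpow : s ^ (-ξ - 1) * s ^ (-(-1 - ξ)) = 1 := by
    rw [← Real.rpow_add hs]
    ring_nf
    exact Real.rpow_zero s
  rw [h, abs_neg, abs_of_pos (by positivity), smul_eq_mul]
  linear_combination (-(boxCox (-ξ) s * Real.exp (-s))) * hpow

lemma integrable_mul_deriv_gevCDF {ξ : ℝ} (hξ : ξ < 1) :
    Integrable fun z : ℝ => z * deriv (gevCDF ξ) z := by
  refine IntegrableOn.integrable_of_ae_notMem_eq_zero (s := {z : ℝ | 0 < 1 + ξ * z}) ?_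
    (ae_deriv_gevCDF_eq_zero ξ)
  rw [← image_neg_boxCox_neg, integrableOn_image_iff_integrableOn_abs_deriv_smul
    measurableSet_Ioi (hasDerivWithinAt_neg_boxCox_neg ξ) (injOn_neg_boxCox_neg ξ)]
  refine (integrableOn_congr_fun (fun s hs => abs_deriv_smul_gevCDF ξ hs) measurableSet_Ioi).2 ?_
  exact (integrableOn_boxCox_mul_exp_neg (by linarith)).neg

lemma gevMean_eq_integral (ξ : ℝ) :
    gevMean ξ = ∫ s in Set.Ioi (0 : ℝ), boxCox ξ s⁻¹ * Real.exp (-s) := by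
  rw [gevMean, ← setIntegral_eq_integral_of_ae_compl_eq_zero (ae_deriv_gevCDF_eq_zero ξ),
    ← image_neg_boxCox_neg, integral_image_eq_integral_abs_deriv_smul
    measurableSet_Ioi (hasDerivWithinAt_neg_boxCox_neg ξ) (injOn_neg_boxCox_neg ξ)]
  refine setIntegral_congr_fun measurableSet_Ioi fun s hs => ?_
  exact (abs_deriv_smul_gevCDF ξ hs).trans (by rw [boxCox_inv ξ hs, neg_mul])

lemma gevMean_eq {ξ : ℝ} (hξ : ξ < 1) :
    gevMean ξ =
      if ξ = 0 then Real.eulerMascheroniConstant else -Real.Gamma (-ξ) - 1 / ξ := by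
  have h : gevMean ξ = -∫ s in Set.Ioi (0 : ℝ), boxCox (-ξ) s * Real.exp (-s) := by
    rw [gevMean_eq_integral, ← integral_neg]
    refine setIntegral_congr_fun measurableSet_Ioi fun s hs => ?_
    simp only [boxCox_inv ξ hs, neg_mul]
  rw [h, integral_boxCox_mul_exp_neg (by linarith)]
  simp only [neg_eq_zero]
  split_ifs
  · rw [neg_neg]
  · rw [div_neg]; ring

/-! ### Dominated convergence for the expected improvement -/

/-- From 1 - u ≤ e^(-u); the exponent n - 1 in place of n costs a factor e^(s/n) ≤ e, so the bound
is uniform in n. -/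
lemma one_sub_div_pow_le {n : ℕ} {s : ℝ} (hs : 0 < s) (hsn : s < n) :
    (1 - s / n) ^ (n - 1) ≤ Real.exp 1 * Real.exp (-s) := by
  have hn0 : (0 : ℝ) < n := hs.trans hsn
  have hn : 1 ≤ n := Nat.cast_pos.1 hn0
  have h1 : s / n < 1 := (div_lt_one hn0).2 hsn
  calc (1 - s / n) ^ (n - 1) ≤ Real.exp (-(s / n)) ^ (n - 1) :=
        pow_le_pow_left₀ (by linarith) (by linarith [Real.add_one_le_exp (-(s / n))]) _
    _ = Real.exp (s / n - s) := by
        rw [← Real.exp_nat_mul, Nat.cast_sub hn, Nat.cast_one]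
        congr 1
        field_simp
        ring
    _ ≤ _ := by
        rw [← Real.exp_add]
        exact Real.exp_le_exp.2 (by linarith)

lemma tendsto_one_sub_div_pow_pred (s : ℝ) :
    Tendsto (fun n : ℕ => (1 - s / n) ^ (n - 1)) atTop (𝓝 (Real.exp (-s))) := by
  have h1 : Tendsto (fun n : ℕ => 1 - s / (n : ℝ)) atTop (𝓝 1) := by
    simpa using (tendsto_const_div_atTop_nhds_zero_nat s).const_sub 1
  have h2 : Tendsto (fun n : ℕ => (1 - s / (n : ℝ)) ^ n) atTop (𝓝 (Real.exp (-s))) := by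
    refine (Real.tendsto_one_add_div_pow_exp (-s)).congr fun n => ?_
    rw [neg_div, sub_eq_add_neg]
  have h3 := h2.div h1 one_ne_zero
  rw [div_one] at h3
  refine h3.congr' ?_
  filter_upwards [h1.eventually (lt_mem_nhds one_pos), eventually_ge_atTop 1] with n hn hn1
  rw [Pi.div_apply, div_eq_iff hn.ne', pow_sub_one_mul (by omega)]

section

variable {Ω : Type*} [MeasurableSpace Ω] {P : Measure Ω} [IsProbabilityMeasure P]
  {X : ℕ → Ω → ℝ} {μ : Measure ℝ} [IsProbabilityMeasure μ]

/-- The expected improvement as an integral of the truncated tail quantile function. -/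
lemma integral_max_runningMax_sub (hmeas : ∀ i, Measurable (X i)) (hindep : iIndepFun X P)
    (hlaw : ∀ i, P.map (X i) = μ) (hint : ∀ i, Integrable (X i) P) {n : ℕ} (hn : 1 ≤ n)
    (x c : ℝ) :
    ∫ ω, max (runningMax X n ω - x) 0 ∂P =
      (∫ s in Set.Ioo 0 (n : ℝ), (1 - s / n) ^ (n - 1) *
        (max (tailQuantile (cdf μ) (n / s)) x - c)) + (c - x) := by
  have hn0 : (0 : ℝ) < n := by positivity
  have hmap := map_runningMax hmeas hindep hlaw hn
  have hac := uniformMinLaw_absolutelyContinuous n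
  have hU : AEMeasurable (fun s => tailQuantile (cdf μ) (n / s)) (uniformMinLaw n) :=
    (aemeasurable_tailQuantile_div μ n).mono_ac hac
  have hZ := (measurable_runningMax hmeas n).aemeasurable (μ := P)
  -- Total mass one is inherited from the law of the maximum through the pushforward; it lets the
  -- constant c - x leave the integral below.
  have hprob : IsProbabilityMeasure (uniformMinLaw n) := by
    have h := Measure.isProbabilityMeasure_map hZ
    rw [hmap] at h
    exact (Measure.isProbabilityMeasure_map_iff hU).1 h
  have hmax : Measurable fun y : ℝ => max (y - x) 0 := by fun_prop
  have hI : Integrable (fun s => max (tailQuantile (cdf μ) (n / s) - x) 0) (uniformMinLaw n) := by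
    have h := (integrable_map_measure (μ := P) hmax.aestronglyMeasurable hZ).2
      (integrable_max_runningMax_sub hmeas hint hn x)
    rw [hmap] at h
    exact (integrable_map_measure hmax.aestronglyMeasurable hU).1 h
  have hdens : ∫ s, (max (tailQuantile (cdf μ) (n / s)) x - c) ∂(uniformMinLaw n) =
      ∫ s in Set.Ioo 0 (n : ℝ), (1 - s / n) ^ (n - 1) *
        (max (tailQuantile (cdf μ) (n / s)) x - c) := by
    rw [uniformMinLaw, integral_withDensity_eq_integral_smul (by fun_prop)]
    refine setIntegral_congr_fun measurableSet_Ioo fun s hs => ?_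
    have : s / n < 1 := (div_lt_one hn0).2 hs.2
    simp only [NNReal.smul_def, smul_eq_mul]
    rw [Real.coe_toNNReal _ (pow_nonneg (by linarith) _)]
  rw [← integral_map (μ := P) hZ hmax.aestronglyMeasurable, hmap,
    integral_map hU hmax.aestronglyMeasurable, ← hdens]
  have hsplit : ∀ y : ℝ, max (y - x) 0 = (max y x - c) + (c - x) := fun y => by
    rw [← sub_self x, max_sub_sub_right]; ring
  have hI' : Integrable (fun s => max (tailQuantile (cdf μ) (n / s)) x - c)
      (uniformMinLaw n) := by
    refine (hI.sub (integrable_const (c - x))).congr (ae_of_all _ fun s => ?_)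
    simp only [Pi.sub_apply, hsplit]; ring
  simp only [hsplit]
  rw [integral_add hI' (integrable_const _), integral_const, probReal_univ, one_smul]

end

/-- Dominated convergence on (0, ∞), with integrands extended by 0 beyond n: the Potter bound
controls the quantile factor and e · e^(-s) the density. -/
lemma tendsto_integral_truncated_tailQuantile (μ : Measure ℝ) {ξ : ℝ} (hξ : ξ < 1) {a : ℝ → ℝ}
    (ha : IsAuxiliary (cdf μ) ξ a) {x : ℝ} (hx : (x : EReal) < rightEndpoint (cdf μ)) :
    Tendsto (fun n : ℕ => (∫ s in Set.Ioo 0 (n : ℝ), (1 - s / n) ^ (n - 1) *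
        (max (tailQuantile (cdf μ) (n / s)) x - tailQuantile (cdf μ) n)) / a n) atTop
      (𝓝 (gevMean ξ)) := by
  obtain ⟨C, ρ, M, t₀, hρ, hM, ht₀, hC⟩ := ha.exists_abs_sub_le μ hξ hx
  set U := tailQuantile (cdf μ)
  let f : ℕ → ℝ → ℝ := fun n s => (Set.Ioo 0 (n : ℝ)).indicator
    (fun s => (1 - s / n) ^ (n - 1) * ((max (U (n / s)) x - U n) / a n)) s
  have hf : ∀ n : ℕ, (∫ s in Set.Ioo 0 (n : ℝ), (1 - s / n) ^ (n - 1) *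
      (max (U (n / s)) x - U n)) / a n = ∫ s in Set.Ioi (0 : ℝ), f n s := fun n => by
    rw [setIntegral_indicator measurableSet_Ioo,
      Set.inter_eq_right.2 Set.Ioo_subset_Ioi_self, ← integral_div]
    simp only [mul_div_assoc]
  rw [gevMean_eq_integral]
  refine Tendsto.congr (fun n => (hf n).symm) ?_
  have hlarge : ∀ᶠ n : ℕ in atTop, t₀ ≤ (n : ℝ) :=
    tendsto_natCast_atTop_atTop.eventually_ge_atTop t₀
  refine tendsto_integral_filter_of_dominated_convergence
    (fun s => C * Real.exp 1 * (s ^ (-ρ) * Real.exp (-s) + s ^ M * Real.exp (-s)))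
    (Eventually.of_forall fun n => ?_) ?_ ?_ ?_
  · have hmeas : AEMeasurable (fun s => (1 - s / n) ^ (n - 1) * ((max (U (n / s)) x - U n) / a n))
        (volume.restrict (Set.Ioo 0 (n : ℝ))) :=
      AEMeasurable.mul (by fun_prop)
        ((((aemeasurable_tailQuantile_div μ n).max aemeasurable_const).sub_const _).div_const _)
    exact ((aemeasurable_indicator_iff measurableSet_Ioo).2 hmeas).aestronglyMeasurable.restrict
  · filter_upwards [hlarge] with n hn
    filter_upwards [ae_restrict_mem measurableSet_Ioi] with s hs
    have hs : 0 < s := hs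
    have han : 0 < a n := ha.1 _ (by linarith)
    have hK : 0 ≤ C * (s ^ (-ρ) + s ^ M) := by
      have h := (abs_nonneg _).trans (hC t₀ (1 / 2) le_rfl (by norm_num) (by linarith))
      -- The sign of C is read off from the Potter bound itself, at t = t₀ and s = 1/2.
      have hC0 : 0 ≤ C := by
        have h2 : 0 < ((1 / 2 : ℝ) ^ (-ρ) + (1 / 2) ^ M) * a t₀ :=
          mul_pos (by positivity) (ha.1 _ ht₀.le)
        rw [mul_assoc] at h
        exact nonneg_of_mul_nonneg_left h h2
      positivity
    by_cases hsn : s < n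
    · have h1 : f n s = (1 - s / n) ^ (n - 1) * ((max (U (n / s)) x - U n) / a n) :=
        Set.indicator_of_mem (show s ∈ Set.Ioo 0 (n : ℝ) from ⟨hs, hsn⟩) _
      have h2 : s / n < 1 := (div_lt_one (hs.trans hsn)).2 hsn
      rw [h1, Real.norm_eq_abs, abs_mul, abs_div, abs_of_pos han,
        abs_of_nonneg (pow_nonneg (by linarith) _)]
      calc _ ≤ Real.exp 1 * Real.exp (-s) * (C * (s ^ (-ρ) + s ^ M)) :=
            mul_le_mul (one_sub_div_pow_le hs hsn)
              ((div_le_iff₀ han).2 (hC n s hn hs hsn)) (by positivity) (by positivity)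
        _ = _ := by ring
    · have h1 : f n s = 0 := Set.indicator_of_notMem (fun h => hsn h.2) _
      rw [h1, norm_zero]
      calc (0 : ℝ) ≤ C * (s ^ (-ρ) + s ^ M) * (Real.exp 1 * Real.exp (-s)) := by positivity
        _ = _ := by ring
  · exact ((integrableOn_rpow_mul_exp_neg (by linarith)).add
      (integrableOn_rpow_mul_exp_neg (by linarith))).const_mul _
  · filter_upwards [ae_restrict_mem measurableSet_Ioi] with s hs
    have hs : 0 < s := hs
    have hlim := ((ha.2 s⁻¹ (inv_pos.2 hs)).comp tendsto_natCast_atTop_atTop).mul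
      (tendsto_one_sub_div_pow_pred s)
    refine hlim.congr' ?_
    -- For fixed s, n/s → ∞, so U(n/s) eventually exceeds x and the truncation disappears.
    filter_upwards [tendsto_natCast_atTop_atTop.eventually_gt_atTop s,
      (tendsto_natCast_atTop_atTop.atTop_div_const hs).eventually
        (eventually_lt_tailQuantile μ hx)] with n hn hxn
    have h1 : f n s = (1 - s / n) ^ (n - 1) * ((max (U (n / s)) x - U n) / a n) :=
      Set.indicator_of_mem (show s ∈ Set.Ioo 0 (n : ℝ) from ⟨hs, hn⟩) _
    rw [h1, max_eq_left hxn.le, Function.comp_apply, ← div_eq_mul_inv, mul_comm]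

end EVT

/-! ### The main theorem -/

theorem theorem1 {Ω : Type*} [MeasurableSpace Ω] (P : Measure Ω) [IsProbabilityMeasure P]
    (X : ℕ → Ω → ℝ) (hmeas : ∀ i, Measurable (X i)) (hindep : iIndepFun X P)
    (F : ℝ → ℝ) (hF : ∀ i x, F x = P.real {ω | X i ω ≤ x})
    (hint : Integrable (X 0) P)
    (ξ : ℝ) (hξ : ξ < 1) (hMDA : EVT.InMaxDomain F (EVT.gevCDF ξ)) :
    -- the mean of `G_ξ` exists and has the stated value
    (Integrable (fun z : ℝ => z * deriv (EVT.gevCDF ξ) z) ∧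
      EVT.gevMean ξ =
        if ξ = 0 then Real.eulerMascheroniConstant else -Real.Gamma (-ξ) - 1 / ξ) ∧
    -- auxiliary functions exist
    (∃ a : ℝ → ℝ, EVT.IsAuxiliary F ξ a) ∧
    -- the expansion of the expected improvement, for every auxiliary function
    ∀ a : ℝ → ℝ, EVT.IsAuxiliary F ξ a →
      ∀ x : ℝ, (x : EReal) < EVT.rightEndpoint F →
        (∀ n : ℕ, 1 ≤ n → Integrable (fun ω => max (EVT.runningMax X n ω - x) 0) P) ∧
        ∃ ε : ℕ → ℝ, Tendsto ε atTop (𝓝 0) ∧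
          ∀ᶠ n : ℕ in atTop,
            ∫ ω, max (EVT.runningMax X n ω - x) 0 ∂P =
              (EVT.gevMean ξ + ε n) * a n + EVT.tailQuantile F n - x := by
  have hprob : ∀ i, IsProbabilityMeasure (P.map (X i)) := fun i =>
    Measure.isProbabilityMeasure_map (hmeas i).aemeasurable
  have hcdf : ∀ i, F = cdf (P.map (X i)) := fun i => by
    ext y
    rw [cdf_eq_real, map_measureReal_apply (hmeas i) measurableSet_Iic, hF i y]
    rfl
  have hlaw : ∀ i, P.map (X i) = P.map (X 0) := fun i => by
    refine Measure.eq_of_cdf _ _ ?_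
    ext y
    rw [← congrFun (hcdf i) y, ← congrFun (hcdf 0) y]
  have hints : ∀ i, Integrable (X i) P := fun i =>
    (IdentDistrib.mk (hmeas i).aemeasurable (hmeas 0).aemeasurable (hlaw i)).integrable_iff.2 hint
  set μ := P.map (X 0)
  obtain rfl : F = cdf μ := hcdf 0
  refine ⟨⟨EVT.integrable_mul_deriv_gevCDF hξ, EVT.gevMean_eq hξ⟩,
    EVT.InMaxDomain.exists_isAuxiliary μ hMDA, fun a ha x hx => ⟨fun n hn =>
      EVT.integrable_max_runningMax_sub hmeas hints hn x, ?_⟩⟩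
  -- The error ε is the normalised integral minus its limit, so the expansion is an exact identity
  -- for every n ≥ 1.
  refine ⟨_, tendsto_sub_nhds_zero_iff.2
    (EVT.tendsto_integral_truncated_tailQuantile μ hξ ha hx), ?_⟩
  filter_upwards [eventually_ge_atTop 1] with n hn
  have han : a n ≠ 0 := (ha.1 n (by exact_mod_cast hn)).ne'
  rw [EVT.integral_max_runningMax_sub hmeas hindep hlaw hints hn x
    (EVT.tailQuantile (cdf μ) n), add_sub_cancel, div_mul_cancel₀ _ han]
  ring
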